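/- Let $\mathcal A$ be a locally small category with the following properties. 1. $\mathcal A$ has all small limits and all small colimits, and is wellpowered (every object has only a set of subobjects). 2. $\mathcal A$ has stable monomorphisms: (a) for every small family of monomorphisms $f_i : X_i \to Y_i$ the coproduct $\coprod_i f_i : \coprod_i X_i \to \coprod_i Y_i$ is a monomorphism; (b) for every small well-ordered (possibly empty) chain of monomorphisms, the colimit injections are monomorphisms, and for every cocone of the chain consisting of monomorphisms, the induced morphism from the colimit is a monomorphism. 3. Every epimorphism in $\mathcal A$ splits. Let $\mathrm{Monad}(\mathcal A)$ be the category of monads on $\mathcal A$ and monad morphisms, and let $D : \mathcal J \to \mathrm{Monad}(\mathcal A)$ be a small diagram with objects $Dj = (S_j,\mu_j,\eta_j)$ such that every functor $S_j$ preserves monomorphisms. Suppose that the functors $S_j$ have arbitrarily large joint pre-fixpoints: for every object $B$ of $\mathcal A$ and every cardinal $\alpha > 0$ there is an object $X$ such that $X + B \cong X \cong \coprod_\alpha X$ and such that, for every $j$, there is a monomorphism $S_j X \to X$. Then $D$ has a colimit in $\mathrm{Monad}(\mathcal A)$. Moreover, the coproducts $\coprod_{f : j \to k} Dj$ (over all morphisms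 $f$ of $\mathcal J$) and $\coprod_{j} Dj$ (over all objects $j$ of $\mathcal J$) exist in $\mathrm{Monad}(\mathcal A)$, and the colimit of $D$, with its colimit injections, is the coequalizer of the two morphisms $$\coprod_{f : j \to k} Dj \rightrightarrows \coprod_{j} Dj$$ whose $f$-th components, for $f : j \to k$, are $\iota_j$ and $\iota_k \cdot Df$, respectively, where $\iota_j$ denotes the coproduct injections of $\coprod_j Dj$. -/

import Mathlib

open CategoryTheory CategoryTheory.Limits

universe v u

namespace SetLikeMonads

/-- A cocomplete category has *stable monomorphisms* if coproducts of families of monomorphisms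
are monomorphisms, and if colimits of (well-ordered, possibly empty) chains of monomorphisms
have monic colimit injections and the factorizing map of every cocone of monomorphisms is monic. -/
class HasStableMonos (A : Type u) [Category.{v} A] [HasColimits A] : Prop where
  mono_sigmaMap : ∀ (I : Type v) (X Y : I → A) (f : ∀ i, X i ⟶ Y i),
    (∀ i, Mono (f i)) → Mono (Limits.Sigma.map f)
  mono_chain_ι : ∀ (I : Type v) [LinearOrder I] [WellFoundedLT I] (F : I ⥤ A),
    (∀ (i j : I) (h : i ⟶ j), Mono (F.map h)) → ∀ i, Mono (colimit.ι F i)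
  mono_chain_desc : ∀ (I : Type v) [LinearOrder I] [WellFoundedLT I] (F : I ⥤ A),
    (∀ (i j : I) (h : i ⟶ j), Mono (F.map h)) →
    ∀ c : Cocone F, (∀ i, Mono (c.ι.app i)) → Mono (colimit.desc F c)

variable {A : Type u} [Category.{v} A]

/-- `Z` is a pre-fixpoint of the endofunctor `H` if `H Z` is a subobject of `Z`. -/
def IsPrefixpoint (H : A ⥤ A) (Z : A) : Prop :=
  ∃ m : H.obj Z ⟶ Z, Mono m

/-- A family of endofunctors has *arbitrarily large joint pre-fixpoints* if for every object `B`
and every cardinal `α > 0` there is a joint pre-fixpoint `X` with `X + B ≅ X ≅ ∐_α X`.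
The cardinal is represented by a nonempty index type `K`. -/
def HasArbitrarilyLargeJointPrefixpoints [HasColimits A] {I : Type*} (F : I → (A ⥤ A)) : Prop :=
  ∀ (B : A) (K : Type v) [Nonempty K],
    ∃ X : A, (∀ i, IsPrefixpoint (F i) X) ∧
      Nonempty ((X ⨿ B) ≅ X) ∧ Nonempty (X ≅ (∐ fun _ : K => X))

section Presentation

variable {C : Type*} [Category* C] {J : Type*} [Category* J] (D : J ⥤ C)

/-- The family of the domains `D j` of all connecting morphisms `j ⟶ k` of a diagram `D`. -/
abbrev arrowDomains (f : Σ p : J × J, p.1 ⟶ p.2) : C := D.obj f.1.1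

/-- The morphism `∐_{f : j ⟶ k} D j ⟶ ∐_j D j` that includes the `f`-th summand as the
`j`-th summand. -/
noncomputable def domainMap [HasCoproduct D.obj] [HasCoproduct (arrowDomains D)] :
    (∐ arrowDomains D) ⟶ (∐ D.obj) :=
  Limits.Sigma.desc fun f => Limits.Sigma.ι D.obj f.1.1

/-- The morphism `∐_{f : j ⟶ k} D j ⟶ ∐_j D j` whose `f`-th component is `D f` followed by the
inclusion of the `k`-th summand. -/
noncomputable def codomainMap [HasCoproduct D.obj] [HasCoproduct (arrowDomains D)] :
    (∐ arrowDomains D) ⟶ (∐ D.obj) :=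
  Limits.Sigma.desc fun f => D.map f.2 ≫ Limits.Sigma.ι D.obj f.1.2

end Presentation

end SetLikeMonads

/-! A `DiagramAlgebra` is an object with compatible algebra structures for all monads S_j = `D.obj
j`. If the forgetful functor from these algebras has a left adjoint, the induced monad is a colimit
of `D`: the vertex T' of a cocone makes every T'X a diagram algebra, and freeness yields the unique
monad morphism into T' (`algebraicColimitOfAdjunction`, `AlgebraicColimit.hasColimit`).

The adjoint comes from the general adjoint functor theorem, so each object B needs a solution set.
The largeness hypothesis provides a pre-fixpoint X of H = B + ∐ S_j. By Zorn, X has a maximal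
recursive subobject; it absorbs its own image under H and is thus a weakly initial H-algebra W
(`exists_weakly_initial_algebra`). Every map from B to a diagram algebra factors through W. As
epimorphisms split, the image of W there is a retract of W, coded by an idempotent on W, and these
form a set (`solutionSetCondition_forget`).

Discrete diagrams give the coproducts, and the coequalizer presentation is then formal. -/

namespace SetLikeMonads

variable {A : Type u} [Category.{v} A]

/-! ### Recursive coalgebras and weakly initial algebras -/

/-- Every linear order has a well-ordered cofinal subset. -/
theorem exists_isCofinal_wellFoundedLT (α : Type*) [LinearOrder α] :
    ∃ s : Set α, IsCofinal s ∧ WellFoundedLT s := by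
  let r : α → α → Prop := WellOrderingRel
  -- The elements exceeding everything that `r` lists before them. On this set `<` implies `r`,
  -- whence well-foundedness; the `r`-first element above a given one belongs to it.
  refine ⟨{a | ∀ b, r b a → b < a}, ?_, ⟨?_⟩⟩
  · intro a
    obtain ⟨b, hb, hmin⟩ := (IsWellFounded.wf (r := r)).has_min {b | a ≤ b} ⟨a, le_rfl⟩
    refine ⟨b, fun c hc => ?_, hb⟩
    by_contra h
    exact hmin c (le_trans hb (not_lt.mp h)) hc
  · refine Subrelation.wf (r := InvImage r Subtype.val) ?_ (InvImage.wf _ IsWellFounded.wf)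
    intro x y hxy
    rcases trichotomous_of r x.1 y.1 with h | h | h
    · exact h
    · exact absurd (Subtype.ext h) hxy.ne
    · exact absurd (x.2 _ h) (not_lt.mpr hxy.le)

/-- A coalgebra `c` is *recursive* if it has a unique coalgebra-to-algebra morphism into every
algebra. -/
def IsRecursive (G : A ⥤ A) {C : A} (c : C ⟶ G.obj C) : Prop :=
  ∀ (Y : A) (a : G.obj Y ⟶ Y), ∃! y : C ⟶ Y, c ≫ G.map y ≫ a = y

/-- If `c` is a recursive coalgebra, then so is `G c`. -/
theorem IsRecursive.map {G : A ⥤ A} {C : A} {c : C ⟶ G.obj C} (hc : IsRecursive G c) :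
    IsRecursive G (G.map c) := by
  intro Y a
  obtain ⟨y, hy, hu⟩ := hc Y a
  -- Solutions for `c` and `G.map c` correspond: `y` gives `G.map y ≫ a`, and `z` gives back `c ≫
  -- z`.
  refine ⟨G.map y ≫ a, ?_, fun z hz => ?_⟩
  · dsimp only
    rw [← Functor.map_comp_assoc, hy]
  · have h : c ≫ z = y := hu _ (by
      dsimp only
      conv_rhs => rw [← hz]
      simp)
    rw [← h, ← hz]
    simp [hz]

theorem IsRecursive.of_iso {G : A ⥤ A} {C C' : A} {c : C ⟶ G.obj C} (hc : IsRecursive G c)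
    (e : C ≅ C') : IsRecursive G (e.inv ≫ c ≫ G.map e.hom) := by
  intro Y a
  obtain ⟨y, hy, hu⟩ := hc Y a
  refine ⟨e.inv ≫ y, ?_, fun z hz => ?_⟩
  · have h : G.map e.hom ≫ G.map (e.inv ≫ y) = G.map y := by
      rw [← G.map_comp, Iso.hom_inv_id_assoc]
    simp only [Category.assoc, reassoc_of% h, hy]
  · rw [Iso.eq_inv_comp]
    refine hu _ ?_
    dsimp only at hz ⊢
    conv_rhs => rw [← hz]
    simp only [Functor.map_comp, Category.assoc, Iso.hom_inv_id_assoc]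

/-- A subobject of `X` that carries a recursive coalgebra compatible with the algebra `m`. -/
def IsRecursiveSubobject {G : A ⥤ A} {X : A} (m : G.obj X ⟶ X) (U : Subobject X) : Prop :=
  ∃ c : (U : A) ⟶ G.obj (U : A), c ≫ G.map U.arrow ≫ m = U.arrow ∧ IsRecursive G c

theorem isRecursiveSubobject_mk {G : A ⥤ A} {X : A} (m : G.obj X ⟶ X) {C : A} (i : C ⟶ X)
    [Mono i] (c : C ⟶ G.obj C) (hi : c ≫ G.map i ≫ m = i) (hc : IsRecursive G c) :
    IsRecursiveSubobject m (Subobject.mk i) := by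
  refine ⟨_, ?_, hc.of_iso (Subobject.underlyingIso i).symm⟩
  simp [← Functor.map_comp_assoc, hi]

/-- A coalgebra morphism from a recursive coalgebra preserves the solutions in an algebra. -/
theorem comp_solution {G : A ⥤ A} {C C' Y : A} {c : C ⟶ G.obj C} (hc : IsRecursive G c)
    {c' : C' ⟶ G.obj C'} (f : C ⟶ C') (hf : c ≫ G.map f = f ≫ c') {a : G.obj Y ⟶ Y}
    {y : C ⟶ Y} (hy : c ≫ G.map y ≫ a = y) {y' : C' ⟶ Y} (hy' : c' ≫ G.map y' ≫ a = y') :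
    f ≫ y' = y := by
  refine (hc Y a).unique ?_ hy
  rw [Functor.map_comp_assoc, reassoc_of% hf, hy']

/-- The colimit of a chain of recursive subcoalgebras is a recursive subcoalgebra. -/
theorem isRecursiveSubobject_colimit [HasColimits A] [HasStableMonos A] {G : A ⥤ A}
    [G.PreservesMonomorphisms] {I : Type v} [LinearOrder I] [WellFoundedLT I] (F : I ⥤ A)
    (s : Cocone F) (m : G.obj s.pt ⟶ s.pt) [Mono m] (hs : ∀ i, Mono (s.ι.app i))
    (c : ∀ i, F.obj i ⟶ G.obj (F.obj i))
    (hc : ∀ i, c i ≫ G.map (s.ι.app i) ≫ m = s.ι.app i)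
    (hrec : ∀ i, IsRecursive G (c i)) :
    ∃ (_ : Mono (colimit.desc F s)),
      IsRecursiveSubobject m (Subobject.mk (colimit.desc F s)) := by
  -- The connecting maps are coalgebra morphisms, as can be tested after the monomorphism `G.map
  -- (s.ι.app j) ≫ m`.
  have hcoh : ∀ {i j : I} (h : i ⟶ j), c i ≫ G.map (F.map h) = F.map h ≫ c j := by
    intro i j h
    rw [← cancel_mono (G.map (s.ι.app j) ≫ m), Category.assoc, Category.assoc, hc,
      ← Functor.map_comp_assoc, s.w, hc]
  have : Mono (colimit.desc F s) :=
    HasStableMonos.mono_chain_desc I F (fun i j h => mono_of_mono_fac (s.w h)) s hs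
  let t : Cocone F := ⟨G.obj (colimit F),
    { app := fun i => c i ≫ G.map (colimit.ι F i)
      naturality := fun i j h => by
        dsimp
        rw [← reassoc_of% (hcoh h), ← G.map_comp, colimit.w, Category.comp_id] }⟩
  have ht : ∀ i, colimit.ι F i ≫ colimit.desc F t = c i ≫ G.map (colimit.ι F i) :=
    fun i => colimit.ι_desc t i
  refine ⟨inferInstance, isRecursiveSubobject_mk m _ (colimit.desc F t) ?_ ?_⟩
  · refine colimit.hom_ext fun i => ?_
    rw [reassoc_of% (ht i), ← Functor.map_comp_assoc, colimit.ι_desc, hc]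
  · intro Y a
    choose y hy using fun i => (hrec i Y a).exists
    let r : Cocone F := ⟨Y,
      { app := fun i => y i
        naturality := fun i j h => by
          dsimp
          rw [comp_solution (hrec i) (F.map h) (hcoh h) (hy i) (hy j), Category.comp_id] }⟩
    have hr : ∀ i, colimit.ι F i ≫ colimit.desc F r = y i := fun i => colimit.ι_desc r i
    refine ⟨colimit.desc F r, colimit.hom_ext fun i => ?_, fun z hz => colimit.hom_ext fun i => ?_⟩
    · rw [reassoc_of% (ht i), ← Functor.map_comp_assoc, hr, hy]
    · rw [hr]
      exact comp_solution (hrec i) _ (ht i).symm (hy i) hz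

/-- Every well-ordered chain of recursive subobjects has a recursive upper bound. -/
theorem exists_upper_bound_of_chain [HasColimits A] [HasStableMonos A] {G : A ⥤ A}
    [G.PreservesMonomorphisms] {X : A} (m : G.obj X ⟶ X) [Mono m] {I : Type v} [LinearOrder I]
    [WellFoundedLT I] (U : I →o Subobject X) (hU : ∀ i, IsRecursiveSubobject m (U i)) :
    ∃ V, IsRecursiveSubobject m V ∧ ∀ i, U i ≤ V := by
  choose c hc hrec using hU
  let F : I ⥤ A := U.monotone.functor ⋙ Subobject.underlying
  let s : Cocone F :=
    { pt := X
      ι := { app := fun i => (U i).arrow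
             naturality := fun i j h =>
              (Subobject.underlying_arrow (U.monotone.functor.map h)).trans
                (Category.comp_id _).symm } }
  obtain ⟨_, h⟩ := isRecursiveSubobject_colimit F s m
    (fun i => inferInstanceAs (Mono (U i).arrow)) c hc hrec
  exact ⟨_, h, fun i => Subobject.le_mk_of_comm (colimit.ι F i) (colimit.ι_desc s i)⟩

/-- An endofunctor preserving monomorphisms that has a pre-fixpoint has a weakly initial
algebra. -/
theorem exists_weakly_initial_algebra [HasColimits A] [HasStableMonos A] [WellPowered.{v} A]
    (G : A ⥤ A) [G.PreservesMonomorphisms] {X : A} (hX : IsPrefixpoint G X) :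
    ∃ (W : A) (w : G.obj W ⟶ W), ∀ (Y : A) (a : G.obj Y ⟶ Y), ∃ g : W ⟶ Y,
      w ≫ g = G.map g ≫ a := by
  obtain ⟨m, hm⟩ := hX
  obtain ⟨U, hU⟩ := zorn_le₀ {U : Subobject X | IsRecursiveSubobject m U} (by
    intro S hS hchain
    classical
    -- Stability concerns only small well-ordered chains: well-poweredness supplies smallness, and a
    -- cofinal subset supplies the well-order.
    let e := equivShrink.{v} S
    let : LinearOrder S :=
      { (inferInstance : PartialOrder S) with
        le_total := fun a b => hchain.total a.2 b.2
        toDecidableLE := Classical.decRel _ }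
    let : LinearOrder (Shrink.{v} S) := LinearOrder.lift' e.symm e.symm.injective
    obtain ⟨s, hs, hwf⟩ := exists_isCofinal_wellFoundedLT (Shrink.{v} S)
    obtain ⟨V, hV, hle⟩ := exists_upper_bound_of_chain m (I := s)
      ⟨fun i => (e.symm i.1).1, fun i j h => h⟩ fun i => hS (e.symm i.1).2
    refine ⟨V, hV, fun z hz => ?_⟩
    obtain ⟨b, hb, hzb⟩ := hs (e ⟨z, hz⟩)
    have h1 : e.symm (e ⟨z, hz⟩) ≤ e.symm b := hzb
    rw [e.symm_apply_apply] at h1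
    exact le_trans h1 (hle ⟨b, hb⟩))
  obtain ⟨c, hc, hrec⟩ := hU.prop
  -- Applying `G` to the coalgebra gives another recursive subobject, lying above `U`; maximality
  -- forces it back into `U`.
  have hle : Subobject.mk (G.map U.arrow ≫ m) ≤ U :=
    hU.le_of_ge (isRecursiveSubobject_mk m _ (G.map c)
      (by rw [← Functor.map_comp_assoc, hc]) hrec.map)
      (Subobject.le_mk_of_comm c hc)
  let w : G.obj (U : A) ⟶ (U : A) :=
    (Subobject.underlyingIso _).inv ≫ Subobject.ofLE _ _ hle
  have hw : w ≫ U.arrow = G.map U.arrow ≫ m := by simp [w]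
  have hwc : w ≫ c = 𝟙 _ := by
    rw [← cancel_mono (G.map U.arrow ≫ m), Category.assoc, hc, hw, Category.id_comp]
  refine ⟨U, w, fun Y a => ?_⟩
  obtain ⟨y, hy⟩ := (hrec Y a).exists
  refine ⟨y, ?_⟩
  conv_lhs => rw [← hy]
  rw [reassoc_of% hwc]

/-! ### Coproducts of endofunctors and stable monomorphisms -/

/-- The pointwise coproduct of a family of endofunctors. -/
noncomputable def sigmaFunctor [HasColimits A] {K : Type v} (H : K → (A ⥤ A)) : A ⥤ A where
  obj Z := ∐ fun k => (H k).obj Z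
  map f := Limits.Sigma.map fun k => (H k).map f

theorem exists_sigmaFunctor_desc [HasColimits A] {K : Type v} (H : K → (A ⥤ A)) (Y : A)
    (a : ∀ k, (H k).obj Y ⟶ Y) :
    ∃ a' : (sigmaFunctor H).obj Y ⟶ Y, ∀ (W : A) (g : W ⟶ Y) (k : K),
      (Limits.Sigma.ι (fun k => (H k).obj W) k : _ ⟶ (sigmaFunctor H).obj W) ≫
        (sigmaFunctor H).map g ≫ a' = (H k).map g ≫ a k := by
  refine ⟨Limits.Sigma.desc a, fun W g k => ?_⟩
  change Limits.Sigma.ι (fun k => (H k).obj W) k ≫ Limits.Sigma.map (fun k => (H k).map g) ≫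
    Limits.Sigma.desc a = _
  rw [Limits.Sigma.ι_map_assoc, Limits.Sigma.ι_desc]

theorem preservesMonomorphisms_sigmaFunctor [HasColimits A] [HasStableMonos A] {K : Type v}
    (H : K → (A ⥤ A)) (hH : ∀ k, (H k).PreservesMonomorphisms) :
    (sigmaFunctor H).PreservesMonomorphisms where
  preserves f _ := HasStableMonos.mono_sigmaMap K _ _ (fun k => (H k).map f) fun k =>
    (hH k).preserves f

theorem isPrefixpoint_sigmaFunctor [HasColimits A] [HasStableMonos A] {K : Type v}
    (H : K → (A ⥤ A)) {X : A} (hX : ∀ k, IsPrefixpoint (H k) X) (e : X ≅ ∐ fun _ : K => X) :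
    IsPrefixpoint (sigmaFunctor H) X := by
  choose m hm using hX
  have : Mono (Limits.Sigma.map m) := HasStableMonos.mono_sigmaMap K _ _ m hm
  exact ⟨Limits.Sigma.map m ≫ e.inv, inferInstanceAs (Mono (Limits.Sigma.map m ≫ e.inv))⟩

/-- The initial object is the colimit of the empty chain, for which every cocone consists vacuously
of monomorphisms. -/
theorem mono_initial_to [HasColimits A] [HasStableMonos A] (X : A) :
    Mono (initial.to X) := by
  let F : PEmpty.{v + 1} ⥤ A := (Functor.const _).obj X
  let s : Cocone F := ⟨X, 𝟙 _⟩
  have : Mono (colimit.desc F s) :=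
    HasStableMonos.mono_chain_desc PEmpty F (fun i => i.elim) s fun i => i.elim
  have h : IsInitial (colimit F) := IsInitial.ofUniqueHom
    (fun Y => colimit.desc F ⟨Y, { app := fun i => i.elim, naturality := fun i => i.elim }⟩)
    fun _ _ => colimit.hom_ext fun i => i.elim
  rw [initialIsInitial.hom_ext (initial.to X) (initial.to (colimit F) ≫ colimit.desc F s)]
  have : IsIso (initial.to (colimit F)) :=
    ⟨h.to _, initialIsInitial.hom_ext _ _, h.hom_ext _ _⟩
  infer_instance

/-- The injection of `B` into the coproduct of `⊥_ A` and `B` is split monic, and stability makes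
the coproduct of `initial.to X` and `𝟙 B` monic. Their composite `q₁` is `coprod.inr` followed by
another map. -/
theorem mono_coprod_inr [HasColimits A] [HasStableMonos A] (X B : A) :
    Mono (coprod.inr : B ⟶ X ⨿ B) := by
  let b : ULift.{v} Bool := ⟨true⟩
  let P : ULift.{v} Bool → A := fun i => bif i.down then B else ⊥_ A
  let Q : ULift.{v} Bool → A := fun i => bif i.down then B else X
  let f : ∀ i, P i ⟶ Q i
    | ⟨true⟩ => 𝟙 B
    | ⟨false⟩ => initial.to X
  let r : ∀ i, P i ⟶ B
    | ⟨true⟩ => 𝟙 B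
    | ⟨false⟩ => initial.to B
  have : Mono (Limits.Sigma.map f) := HasStableMonos.mono_sigmaMap _ P Q f (by
    rintro ⟨_ | _⟩
    · exact mono_initial_to X
    · exact inferInstanceAs (Mono (𝟙 B)))
  let i₁ : B ⟶ ∐ P := Limits.Sigma.ι P ⟨true⟩
  have hi : i₁ ≫ Limits.Sigma.desc r = 𝟙 B := Limits.Sigma.ι_desc r ⟨true⟩
  have : Mono (i₁ ≫ Limits.Sigma.desc r) := by rw [hi]; infer_instance
  have : Mono i₁ := mono_of_mono i₁ (Limits.Sigma.desc r)
  let q₀ : X ⟶ ∐ Q := Limits.Sigma.ι Q ⟨false⟩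
  let q₁ : B ⟶ ∐ Q := Limits.Sigma.ι Q ⟨true⟩
  have hq : i₁ ≫ Limits.Sigma.map f = 𝟙 B ≫ q₁ := Limits.Sigma.ι_map f ⟨true⟩
  have : Mono q₁ := by
    rw [Category.id_comp] at hq
    rw [← hq]
    infer_instance
  exact mono_of_mono_fac (coprod.inr_desc q₀ q₁)

/-! ### Algebras for a diagram of monads and their limits -/

section DiagramAlgebra

variable {J : Type v} [SmallCategory J]

/-- An algebra for a diagram `D` of monads: an object with an algebra structure for every
monad `D j`, compatible with the connecting morphisms of the diagram. -/
structure DiagramAlgebra (D : J ⥤ Monad A) where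
  /-- The underlying object. -/
  carrier : A
  /-- The algebra structures. -/
  str : ∀ j, (D.obj j).obj carrier ⟶ carrier
  unit : ∀ j, (D.obj j).η.app carrier ≫ str j = 𝟙 carrier
  assoc : ∀ j, (D.obj j).μ.app carrier ≫ str j = (D.obj j).map (str j) ≫ str j
  compat : ∀ {j k : J} (f : j ⟶ k), (D.map f).app carrier ≫ str k = str j

namespace DiagramAlgebra

variable {D : J ⥤ Monad A}

/-- Morphisms of algebras for a diagram of monads. -/
@[ext]
structure Hom (X Y : DiagramAlgebra D) where
  /-- The underlying morphism. -/
  f : X.carrier ⟶ Y.carrier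
  h : ∀ j, (D.obj j).map f ≫ Y.str j = X.str j ≫ f

instance : Category (DiagramAlgebra D) where
  Hom X Y := Hom X Y
  id X := ⟨𝟙 _, fun j => by simp⟩
  comp p q := ⟨p.f ≫ q.f, fun j => by
    rw [Functor.map_comp, Category.assoc, q.h, ← Category.assoc, p.h, Category.assoc]⟩

@[ext]
theorem hom_ext {X Y : DiagramAlgebra D} {p q : X ⟶ Y} (h : p.f = q.f) : p = q :=
  Hom.ext h

variable (D) in
/-- The forgetful functor to the base category. -/
def forget : DiagramAlgebra D ⥤ A where
  obj X := X.carrier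
  map p := p.f

section JointlyMono

variable {K : Type*} (Y : K → DiagramAlgebra D) {X : A} (π : ∀ k, X ⟶ (Y k).carrier)
  (hπ : ∀ {T : A} (p q : T ⟶ X), (∀ k, p ≫ π k = q ≫ π k) → p = q)
  (a : ∀ j, (D.obj j).obj X ⟶ X)
  (ha : ∀ j k, (D.obj j).map (π k) ≫ (Y k).str j = a j ≫ π k)

/-- An object with operations and with a jointly monic family of operation-preserving morphisms
into algebras is an algebra. -/
def ofJointlyMono : DiagramAlgebra D where
  carrier := X
  str := a
  unit j := hπ _ _ fun k => by
    rw [Category.assoc, ← ha]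
    exact (Category.assoc _ _ _).symm.trans
      ((congrArg (· ≫ (Y k).str j) ((D.obj j).unit_naturality A (π k))).symm.trans
        ((Category.assoc _ _ _).trans ((congrArg (π k ≫ ·) ((Y k).unit j)).trans
          ((Category.comp_id _).trans (Category.id_comp _).symm))))
  assoc j := hπ _ _ fun k => by
    rw [Category.assoc, Category.assoc, ← ha, ← Functor.map_comp_assoc, ← ha,
      ← Monad.mu_naturality_assoc, (Y k).assoc, Functor.map_comp_assoc]
  compat f := hπ _ _ fun k => by
    rw [Category.assoc, ← ha, ← ha, ← (Y k).compat f]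
    exact ((D.map f).naturality_assoc (π k) _).symm

/-- The jointly monic morphisms out of `ofJointlyMono`. -/
def ofJointlyMonoπ (k : K) : ofJointlyMono Y π hπ a ha ⟶ Y k := ⟨π k, fun j => ha j k⟩

/-- A morphism into `ofJointlyMono` is a homomorphism if all of its components are. -/
def liftOfJointlyMono {Z : DiagramAlgebra D} (p : Z.carrier ⟶ X) (q : ∀ k, Z ⟶ Y k)
    (hq : ∀ k, p ≫ π k = (q k).f) : Z ⟶ ofJointlyMono Y π hπ a ha where
  f := p
  h j := hπ _ _ fun k => by
    change ((D.obj j).map p ≫ a j) ≫ π k = (Z.str j ≫ p) ≫ π k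
    rw [Category.assoc, Category.assoc, hq, ← ha, ← (q k).h, ← hq, Functor.map_comp_assoc]

end JointlyMono

section Limits

variable [HasLimits A] {K : Type v} [SmallCategory K] (F : K ⥤ DiagramAlgebra D)

/-- The projections of the limit of the underlying objects. -/
noncomputable def limitπ (k : K) : limit (F ⋙ forget D) ⟶ (F.obj k).carrier :=
  limit.π (F ⋙ forget D) k

theorem limitπ_ext {T : A} (p q : T ⟶ limit (F ⋙ forget D))
    (h : ∀ k, p ≫ limitπ F k = q ≫ limitπ F k) : p = q :=
  limit.hom_ext h

theorem limitπ_w {k l : K} (f : k ⟶ l) : limitπ F k ≫ (F.map f).f = limitπ F l :=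
  limit.w (F ⋙ forget D) f

theorem exists_limitStr (j : J) :
    ∃ a : (D.obj j).obj (limit (F ⋙ forget D)) ⟶ limit (F ⋙ forget D),
      ∀ k, (D.obj j).map (limitπ F k) ≫ (F.obj k).str j = a ≫ limitπ F k := by
  have h : ∀ {k l : K} (f : k ⟶ l), (D.obj j).map (limitπ F l) ≫ (F.obj l).str j =
      ((D.obj j).map (limitπ F k) ≫ (F.obj k).str j) ≫ (F.map f).f := by
    intro k l f
    rw [← limitπ_w F f, Functor.map_comp_assoc, (F.map f).h j, Category.assoc]
  let c : Cone (F ⋙ forget D) :=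
    { pt := (D.obj j).obj (limit (F ⋙ forget D))
      π :=
        { app := fun k => (D.obj j).map (limitπ F k) ≫ (F.obj k).str j
          naturality := fun _ _ f => (Category.id_comp _).trans (h f) } }
  exact ⟨limit.lift (F ⋙ forget D) c, fun k => (limit.lift_π c k).symm⟩

/-- The limit of a diagram of algebras. -/
noncomputable def limitAlgebra : DiagramAlgebra D :=
  ofJointlyMono F.obj (limitπ F) (limitπ_ext F) (fun j => (exists_limitStr F j).choose)
    (fun j => (exists_limitStr F j).choose_spec)

/-- The projections of the limit of a diagram of algebras. -/
noncomputable def limitAlgebraπ (k : K) : limitAlgebra F ⟶ F.obj k :=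
  ofJointlyMonoπ F.obj (limitπ F) (limitπ_ext F) _ (fun j => (exists_limitStr F j).choose_spec) k

/-- The limit cone of a diagram of algebras. -/
noncomputable def limitCone : Cone F where
  pt := limitAlgebra F
  π :=
    { app := limitAlgebraπ F
      naturality := fun _ l f => (Category.id_comp (limitAlgebraπ F l)).trans
        (hom_ext (limitπ_w F f).symm) }

/-- The morphism into the limit algebra induced by a cone. -/
noncomputable def limitAlgebraLift (s : Cone F) : s.pt ⟶ limitAlgebra F :=
  liftOfJointlyMono F.obj (limitπ F) (limitπ_ext F) _
    (fun j => (exists_limitStr F j).choose_spec)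
    (limit.lift (F ⋙ forget D) ((forget D).mapCone s)) s.π.app
    fun k => limit.lift_π ((forget D).mapCone s) k

/-- The limit cone of a diagram of algebras is a limit cone. -/
noncomputable def limitConeIsLimit : IsLimit (limitCone F) where
  lift s := limitAlgebraLift F s
  fac s k := hom_ext (limit.lift_π ((forget D).mapCone s) k)
  uniq s _ hm := hom_ext (limitπ_ext F _ _ fun k =>
    (congrArg Hom.f (hm k)).trans (limit.lift_π ((forget D).mapCone s) k).symm)

instance : HasLimitsOfSize.{v, v} (DiagramAlgebra D) where
  has_limits_of_shape _ _ := ⟨fun F => ⟨⟨⟨limitCone F, limitConeIsLimit F⟩⟩⟩⟩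

instance : PreservesLimitsOfSize.{v, v} (forget D) where
  preservesLimitsOfShape :=
    { preservesLimit := fun {F} => preservesLimit_of_preserves_limit_cone (limitConeIsLimit F)
        (IsLimit.ofIsoLimit (limit.isLimit (F ⋙ forget D))
          (Cone.ext (Iso.refl _) fun k => (Category.id_comp (limitπ F k)).symm)) }

end Limits

end DiagramAlgebra

end DiagramAlgebra

/-! ### Split images and the left adjoint of the forgetful functor -/

/-- If every epimorphism splits, then every morphism factors as a split epimorphism followed by
a monomorphism. -/
theorem exists_splitEpi_mono_factorization [HasLimits A] [HasColimits A] [SplitEpiCategory A]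
    {X Y : A} (g : X ⟶ Y) :
    ∃ (I : A) (p : X ⟶ I) (s : I ⟶ X) (i : I ⟶ Y), s ≫ p = 𝟙 I ∧ p ≫ i = g ∧ Mono i := by
  -- The quotient by the kernel pair of `g`; a section of it lets two maps that `i` identifies be
  -- lifted to `X`, where they factor through the kernel pair.
  let p := coequalizer.π (pullback.fst g g) (pullback.snd g g)
  let i := coequalizer.desc (f := pullback.fst g g) (g := pullback.snd g g) g pullback.condition
  have hpi : p ≫ i = g := coequalizer.π_desc _ _
  have : IsSplitEpi p := isSplitEpi_of_epi p
  refine ⟨_, p, section_ p, i, IsSplitEpi.id p, hpi, ⟨fun a b hab => ?_⟩⟩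
  have hs : section_ p ≫ g = i := by
    have h := IsSplitEpi.id_assoc p i
    rwa [hpi] at h
  have h : (a ≫ section_ p) ≫ g = (b ≫ section_ p) ≫ g := by
    rw [Category.assoc, Category.assoc, hs, hab]
  have h' : (a ≫ section_ p) ≫ p = (b ≫ section_ p) ≫ p := by
    rw [← pullback.lift_fst _ _ h, Category.assoc, coequalizer.condition, ← Category.assoc,
      pullback.lift_snd]
  simpa using h'

section SolutionSet

variable {J : Type v} [SmallCategory J] {D : J ⥤ Monad A}

/-- The solution set condition holds as soon as there is a weakly initial object among the
objects with a morphism from `B` and operations of all the monads of the diagram. -/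
theorem solutionSetCondition_forget [HasLimits A] [HasColimits A] [SplitEpiCategory A]
    (hW : ∀ B : A, ∃ (W : A) (b : B ⟶ W) (w : ∀ j, (D.obj j).obj W ⟶ W),
      ∀ (Y : DiagramAlgebra D) (h : B ⟶ Y.carrier), ∃ g : W ⟶ Y.carrier, b ≫ g = h ∧
        ∀ j, w j ≫ g = (D.obj j).map g ≫ Y.str j) :
    SolutionSetCondition.{v} (DiagramAlgebra.forget D) := by
  intro B
  obtain ⟨W, b, w, hW⟩ := hW B
  -- Algebra quotients of `W` that are retracts, indexed by the idempotent `p ≫ s`; local smallness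
  -- makes this a small type.
  let ι := {e : W ⟶ W // ∃ (Y : DiagramAlgebra D) (p : W ⟶ Y.carrier) (s : Y.carrier ⟶ W),
    s ≫ p = 𝟙 _ ∧ p ≫ s = e ∧ ∀ j, w j ≫ p = (D.obj j).map p ≫ Y.str j}
  choose Y p s hsp hps hp using fun e : ι => e.2
  refine ⟨ι, Y, fun e => b ≫ p e, fun X h => ?_⟩
  obtain ⟨g, hbg, hg⟩ := hW X h
  obtain ⟨I, q, t, i, htq, hqi, _⟩ := exists_splitEpi_mono_factorization g
  have hti : t ≫ g = i := by rw [← hqi, reassoc_of% htq]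
  have ha : ∀ j, (D.obj j).map i ≫ X.str j = ((D.obj j).map t ≫ w j ≫ q) ≫ i := by
    intro j
    rw [Category.assoc, Category.assoc, hqi, hg, ← Functor.map_comp_assoc, hti]
  have hq : ∀ j, w j ≫ q = (D.obj j).map q ≫ (D.obj j).map t ≫ w j ≫ q := by
    intro j
    rw [← cancel_mono i, Category.assoc, Category.assoc, ← ha, hqi, hg, ← Functor.map_comp_assoc,
      hqi]
  let Z : DiagramAlgebra D := DiagramAlgebra.ofJointlyMono (fun _ : Unit => X) (fun _ => i)
    (fun p q h => (cancel_mono i).mp (h ())) _ fun j _ => ha j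
  let e : ι := ⟨q ≫ t, Z, q, t, htq, rfl, hq⟩
  -- The splitting chosen for `e` need not be the one through `Z`, but both have the same idempotent
  -- `q ≫ t`, and this fixes `g`.
  have hpg : p e ≫ s e ≫ g = g := by
    rw [← Category.assoc, hps e]
    change (q ≫ t) ≫ g = g
    rw [Category.assoc, hti, hqi]
  refine ⟨e, ⟨s e ≫ g, fun j => ?_⟩, ?_⟩
  · have h1 : (D.obj j).map (s e) ≫ (D.obj j).map (p e) = 𝟙 _ := by
      rw [← Functor.map_comp, hsp, CategoryTheory.Functor.map_id]
    have h2 : (Y e).str j = (D.obj j).map (s e) ≫ w j ≫ p e := by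
      rw [hp, reassoc_of% h1]
    rw [h2, Category.assoc, Category.assoc, hpg, hg, Functor.map_comp_assoc]
  · change (b ≫ p e) ≫ s e ≫ g = h
    rw [Category.assoc, hpg, hbg]

theorem isRightAdjoint_forget [HasLimits A] [HasColimits A] [HasStableMonos A]
    [SplitEpiCategory A] [WellPowered.{v} A]
    (hmono : ∀ j, (D.obj j).toFunctor.PreservesMonomorphisms)
    (hlarge : HasArbitrarilyLargeJointPrefixpoints (fun j => (D.obj j).toFunctor)) :
    (DiagramAlgebra.forget D).IsRightAdjoint := by
  refine isRightAdjoint_of_preservesLimits_of_solutionSetCondition _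
    (solutionSetCondition_forget fun B => ?_)
  -- The extra index `none` stands for the constant functor at `B`, and keeps the index type
  -- nonempty when `J` is empty.
  obtain ⟨X, hX, ⟨e₁⟩, ⟨e₂⟩⟩ := hlarge B (Option J)
  let H : Option J → (A ⥤ A) :=
    fun o => o.elim ((Functor.const A).obj B) fun j => (D.obj j).toFunctor
  have hHX : ∀ o, IsPrefixpoint (H o) X := by
    rintro (_ | j)
    · have := mono_coprod_inr X B
      exact ⟨(coprod.inr : B ⟶ X ⨿ B) ≫ e₁.hom, mono_comp (coprod.inr : B ⟶ X ⨿ B) e₁.hom⟩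
    · exact hX j
  have hH : ∀ o, (H o).PreservesMonomorphisms := by
    rintro (_ | j)
    · exact ⟨fun f _ => inferInstanceAs (Mono (𝟙 B))⟩
    · exact hmono j
  have := preservesMonomorphisms_sigmaFunctor H hH
  obtain ⟨W, w, hW⟩ := exists_weakly_initial_algebra (sigmaFunctor H)
    (isPrefixpoint_sigmaFunctor H hHX e₂)
  let ι : ∀ o, (H o).obj W ⟶ (sigmaFunctor H).obj W := Limits.Sigma.ι fun o => (H o).obj W
  refine ⟨W, ι none ≫ w, fun j => ι (some j) ≫ w, fun Y h => ?_⟩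
  let a : ∀ o, (H o).obj Y.carrier ⟶ Y.carrier
    | none => h
    | some j => Y.str j
  obtain ⟨a', ha'⟩ := exists_sigmaFunctor_desc H Y.carrier a
  obtain ⟨g, hg⟩ := hW Y.carrier a'
  have key : ∀ o, (ι o ≫ w) ≫ g = (H o).map g ≫ a o := fun o => by
    rw [Category.assoc, hg]
    exact ha' W g o
  exact ⟨g, (key none).trans (Category.id_comp _), fun j => key (some j)⟩

end SolutionSet

/-! ### Free diagram algebras form the colimit monad -/

section AlgebraicColimit

variable {J : Type v} [SmallCategory J] {D : J ⥤ Monad A}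

/-- A morphism between objects equipped with operations `D j Z ⟶ Z` that preserves them. -/
def PreservesOps {Z W : A} (s : ∀ j, (D.obj j).obj Z ⟶ Z) (t : ∀ j, (D.obj j).obj W ⟶ W)
    (p : Z ⟶ W) : Prop :=
  ∀ j, (D.obj j).map p ≫ t j = s j ≫ p

theorem PreservesOps.comp {X Y Z : A} {r : ∀ j, (D.obj j).obj X ⟶ X}
    {s : ∀ j, (D.obj j).obj Y ⟶ Y} {t : ∀ j, (D.obj j).obj Z ⟶ Z} {p : X ⟶ Y} {q : Y ⟶ Z}
    (hp : PreservesOps r s p) (hq : PreservesOps s t q) : PreservesOps r t (p ≫ q) := fun j => by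
  rw [Functor.map_comp, Category.assoc, hq, ← Category.assoc, hp, Category.assoc]

/-- The operations on `T X` that are induced by morphisms of monads into `T`. -/
def inducedOps {T : Monad A} (τ : ∀ j, D.obj j ⟶ T) (X : A) (j : J) :
    (D.obj j).obj (T.obj X) ⟶ T.obj X :=
  (τ j).app (T.obj X) ≫ T.μ.app X

theorem preservesOps_map {T : Monad A} (τ : ∀ j, D.obj j ⟶ T) {X Y : A} (f : X ⟶ Y) :
    PreservesOps (inducedOps τ X) (inducedOps τ Y) (T.map f) := fun j => by
  rw [inducedOps, inducedOps, (τ j).naturality_assoc, T.mu_naturality, Category.assoc]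

theorem preservesOps_μ {T : Monad A} (τ : ∀ j, D.obj j ⟶ T) (X : A) :
    PreservesOps (inducedOps τ (T.obj X)) (inducedOps τ X) (T.μ.app X) := fun j => by
  rw [inducedOps, inducedOps, (τ j).naturality_assoc, T.assoc, Category.assoc]

/-- A cocone of monads turns the values of its vertex into algebras for the diagram. -/
def algebraOfCocone {T : Monad A} (τ : ∀ j, D.obj j ⟶ T)
    (hτ : ∀ {j k : J} (f : j ⟶ k), D.map f ≫ τ k = τ j) (X : A) : DiagramAlgebra D where
  carrier := T.obj X
  str := inducedOps τ X
  unit j := by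
    exact (Category.assoc _ _ _).symm.trans ((congrArg (· ≫ T.μ.app X)
      (MonadHom.app_η (τ j) (T.obj X))).trans (T.left_unit X))
  assoc j := by
    rw [inducedOps, MonadHom.app_μ_assoc, Functor.map_comp, Category.assoc, ← T.assoc,
      (τ j).naturality_assoc (T.μ.app X)]
    rfl
  compat f := by
    rw [inducedOps, inducedOps, ← hτ f]
    exact (Category.assoc _ _ _).symm

variable (D) in
/-- A monad `T` is an *algebraic colimit* of the diagram `D` if the objects `T X` are, compatibly
with the monad structure, free algebras for the diagram. -/
structure AlgebraicColimit (T : Monad A) where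
  /-- The free algebras. -/
  str : ∀ j X, (D.obj j).obj (T.obj X) ⟶ T.obj X
  unit : ∀ j X, (D.obj j).η.app (T.obj X) ≫ str j X = 𝟙 (T.obj X)
  assoc : ∀ j X, (D.obj j).μ.app (T.obj X) ≫ str j X = (D.obj j).map (str j X) ≫ str j X
  compat : ∀ {j k : J} (f : j ⟶ k) (X : A), (D.map f).app (T.obj X) ≫ str k X = str j X
  map_str : ∀ {X Y : A} (f : X ⟶ Y),
    PreservesOps (fun j => str j X) (fun j => str j Y) (T.map f)
  mu_str : ∀ X, PreservesOps (fun j => str j (T.obj X)) (fun j => str j X) (T.μ.app X)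
  exists_desc : ∀ (X : A) (Y : DiagramAlgebra D) (h : X ⟶ Y.carrier),
    ∃ p : T.obj X ⟶ Y.carrier, T.η.app X ≫ p = h ∧ PreservesOps (fun j => str j X) Y.str p
  hom_ext : ∀ (X : A) (Y : DiagramAlgebra D) (p q : T.obj X ⟶ Y.carrier),
    PreservesOps (fun j => str j X) Y.str p → PreservesOps (fun j => str j X) Y.str q →
    T.η.app X ≫ p = T.η.app X ≫ q → p = q

namespace AlgebraicColimit

variable {T : Monad A} (c : AlgebraicColimit D T)

/-- The colimit injections of an algebraic colimit. -/
def ι (j : J) : D.obj j ⟶ T where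
  app X := (D.obj j).map (T.η.app X) ≫ c.str j X
  naturality X Y f := by
    have h := T.unit_naturality A f
    rw [Category.assoc, ← c.map_str, ← Functor.map_comp_assoc, ← Functor.map_comp_assoc]
    exact congrArg (fun x => (D.obj j).map x ≫ c.str j Y) h
  app_η X := by
    refine (Category.assoc _ _ _).symm.trans
      ((congrArg (· ≫ c.str j X) ((D.obj j).unit_naturality A (T.η.app X))).symm.trans ?_)
    exact (Category.assoc _ _ _).trans
      ((congrArg (T.η.app X ≫ ·) (c.unit j X)).trans (Category.comp_id _))
  app_μ X := by
    have h1 : (D.obj j).map (T.η.app (T.obj X)) ≫ (D.obj j).map (T.μ.app X) = 𝟙 _ := by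
      rw [← Functor.map_comp]
      exact (congrArg (D.obj j).map (T.left_unit X)).trans ((D.obj j).toFunctor.map_id _)
    have h2 : ((D.obj j).map (T.η.app (T.obj X)) ≫ c.str j (T.obj X)) ≫ T.μ.app X =
        c.str j X := by
      rw [Category.assoc, ← c.mu_str, reassoc_of% h1]
    rw [Category.assoc, h2, Functor.map_comp, Category.assoc, ← c.assoc]
    exact ((D.obj j).mu_naturality_assoc A _ _).symm

theorem ι_app (j : J) (X : A) : (c.ι j).app X = (D.obj j).map (T.η.app X) ≫ c.str j X := rfl

theorem ι_w {j k : J} (f : j ⟶ k) : D.map f ≫ c.ι k = c.ι j := by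
  refine MonadHom.ext' _ _ (funext fun X => ?_)
  change (D.map f).app X ≫ (D.obj k).map (T.η.app X) ≫ c.str k X = _
  rw [ι_app, ← c.compat f]
  exact ((D.map f).naturality_assoc _ _).symm

theorem ι_app_mu (j : J) (X : A) : (c.ι j).app (T.obj X) ≫ T.μ.app X = c.str j X := by
  have h1 : (D.obj j).map (T.η.app (T.obj X)) ≫ (D.obj j).map (T.μ.app X) = 𝟙 _ := by
    rw [← Functor.map_comp]
    exact (congrArg (D.obj j).map (T.left_unit X)).trans ((D.obj j).toFunctor.map_id _)
  rw [ι_app, Category.assoc, ← c.mu_str, reassoc_of% h1]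

variable {T' : Monad A} (τ : ∀ j, D.obj j ⟶ T')
  (hτ : ∀ {j k : J} (f : j ⟶ k), D.map f ≫ τ k = τ j)

/-- The components of the morphism from an algebraic colimit induced by a cocone. -/
noncomputable def descApp (X : A) : T.obj X ⟶ T'.obj X :=
  (c.exists_desc X (algebraOfCocone τ hτ X) (T'.η.app X)).choose

theorem η_descApp (X : A) : T.η.app X ≫ c.descApp τ hτ X = T'.η.app X :=
  (c.exists_desc X (algebraOfCocone τ hτ X) (T'.η.app X)).choose_spec.1

theorem str_descApp (X : A) :
    PreservesOps (fun j => c.str j X) (inducedOps τ X) (c.descApp τ hτ X) :=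
  (c.exists_desc X (algebraOfCocone τ hτ X) (T'.η.app X)).choose_spec.2

theorem desc_ext (hτ : ∀ {j k : J} (f : j ⟶ k), D.map f ≫ τ k = τ j) {X Y : A} {p q : T.obj X ⟶ T'.obj Y}
    (hp : PreservesOps (fun j => c.str j X) (inducedOps τ Y) p)
    (hq : PreservesOps (fun j => c.str j X) (inducedOps τ Y) q)
    (h : T.η.app X ≫ p = T.η.app X ≫ q) : p = q :=
  c.hom_ext X (algebraOfCocone τ hτ Y) p q hp hq h

/-- The morphism from an algebraic colimit induced by a cocone. -/
noncomputable def desc : T ⟶ T' where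
  app X := c.descApp τ hτ X
  naturality X Y f := by
    -- Both composites are homomorphisms out of a free algebra, so agreement on the unit suffices;
    -- `app_μ` is proved in the same way.
    refine c.desc_ext τ hτ
      ((c.map_str f).comp (c.str_descApp τ hτ Y))
      ((c.str_descApp τ hτ X).comp (preservesOps_map τ f)) ?_
    have h1 := T.unit_naturality A f
    have h2 := T'.unit_naturality A f
    rw [← Category.assoc, ← Category.assoc, c.η_descApp]
    refine (congrArg (· ≫ c.descApp τ hτ Y) h1).symm.trans ?_
    exact (Category.assoc _ _ _).trans ((congrArg (f ≫ ·) (c.η_descApp τ hτ Y)).trans h2)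
  app_η X := c.η_descApp τ hτ X
  app_μ X := by
    refine c.desc_ext τ hτ
      ((c.mu_str X).comp (c.str_descApp τ hτ X))
      (((c.map_str _).comp (c.str_descApp τ hτ _)).comp (preservesOps_μ τ X)) ?_
    have h1 := T.unit_naturality A (c.descApp τ hτ X)
    rw [T.left_unit_assoc, ← Category.assoc, ← Category.assoc]
    refine Eq.symm ((congrArg (fun x => (x ≫ c.descApp τ hτ (T'.obj X)) ≫ T'.μ.app X)
      h1).symm.trans ?_)
    have h2 := c.η_descApp τ hτ (T'.obj X)
    refine (congrArg (· ≫ T'.μ.app X) ((Category.assoc _ _ _).trans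
      (congrArg (c.descApp τ hτ X ≫ ·) h2))).trans ?_
    exact (Category.assoc _ _ _).trans
      ((congrArg (c.descApp τ hτ X ≫ ·) (T'.left_unit X)).trans (Category.comp_id _))

theorem ι_desc (j : J) : c.ι j ≫ c.desc τ hτ = τ j := by
  refine MonadHom.ext' _ _ (funext fun X => ?_)
  change (c.ι j).app X ≫ c.descApp τ hτ X = (τ j).app X
  rw [ι_app, Category.assoc, ← c.str_descApp τ hτ X j, ← Functor.map_comp_assoc]
  refine (congrArg (fun x => (D.obj j).map x ≫ inducedOps τ X j) (c.η_descApp τ hτ X)).trans ?_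
  rw [inducedOps]
  refine ((τ j).naturality_assoc (T'.η.app X) (T'.μ.app X)).trans ?_
  rw [T'.right_unit]
  exact Category.comp_id _

/-- By `ι_app_mu` the operations `c.str` are recovered from the injections and the multiplication,
so a monad morphism compatible with the injections preserves operations. Freeness then leaves only
the units to compare. -/
theorem hom_ext_of_ι {ψ ψ' : T ⟶ T'} (hψ : ∀ j, c.ι j ≫ ψ = τ j) (hψ' : ∀ j, c.ι j ≫ ψ' = τ j)
    (hτ : ∀ {j k : J} (f : j ⟶ k), D.map f ≫ τ k = τ j) : ψ = ψ' := by
  have key : ∀ φ : T ⟶ T', (∀ j, c.ι j ≫ φ = τ j) → ∀ X,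
      PreservesOps (fun j => c.str j X) (inducedOps τ X) (φ.app X) := by
    intro φ hφ X j
    have h : (τ j).app (T'.obj X) = (c.ι j).app (T'.obj X) ≫ φ.app (T'.obj X) := by
      rw [← hφ j]; rfl
    dsimp only
    rw [← c.ι_app_mu, Category.assoc, MonadHom.app_μ, inducedOps, h,
      Category.assoc, Category.assoc, (c.ι j).naturality_assoc]
  refine MonadHom.ext' _ _ (funext fun X => ?_)
  refine c.desc_ext τ hτ (key ψ hψ X) (key ψ' hψ' X) ?_
  exact (MonadHom.app_η ψ X).trans (MonadHom.app_η ψ' X).symm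

theorem hasColimit {T : Monad A} (c : AlgebraicColimit D T) : HasColimit D := by
  let s : Cocone D :=
    { pt := T
      ι := { app := c.ι, naturality := fun _ _ f => (c.ι_w f).trans (Category.comp_id _).symm } }
  have hw : ∀ (t : Cocone D) {j k : J} (f : j ⟶ k), D.map f ≫ t.ι.app k = t.ι.app j :=
    fun t _ _ f => t.w f
  exact ⟨⟨⟨s,
    { desc := fun t => c.desc (T' := t.pt) t.ι.app (hw t)
      fac := fun t j => c.ι_desc (T' := t.pt) t.ι.app (hw t) j
      uniq := fun t m hm => c.hom_ext_of_ι (T' := t.pt) t.ι.app hm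
        (c.ι_desc (T' := t.pt) t.ι.app (hw t)) (hw t) }⟩⟩⟩

end AlgebraicColimit

/-- If the forgetful functor from the algebras of a diagram has a left adjoint, then the monad of
free algebras is the algebraic colimit of the diagram. -/
def algebraicColimitOfAdjunction {L : A ⥤ DiagramAlgebra D}
    (adj : L ⊣ DiagramAlgebra.forget D) : AlgebraicColimit D adj.toMonad where
  str j X := (L.obj X).str j
  unit j X := (L.obj X).unit j
  assoc j X := (L.obj X).assoc j
  compat f X := (L.obj X).compat f
  map_str f := (L.map f).h
  mu_str X := (adj.counit.app (L.obj X)).h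
  exists_desc X Y h := ⟨((adj.homEquiv X Y).symm h).f,
    (adj.homEquiv_unit X Y _).symm.trans ((adj.homEquiv X Y).apply_symm_apply h),
    ((adj.homEquiv X Y).symm h).h⟩
  hom_ext X Y p q hp hq h := by
    let p' : L.obj X ⟶ Y := ⟨p, hp⟩
    let q' : L.obj X ⟶ Y := ⟨q, hq⟩
    have h' : p' = q' := (adj.homEquiv X Y).injective
      ((adj.homEquiv_unit X Y p').trans (h.trans (adj.homEquiv_unit X Y q').symm))
    exact congrArg DiagramAlgebra.Hom.f h'

end AlgebraicColimit

/-! ### Existence of colimits and coproducts of monads -/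

theorem hasColimit_of_largeJointPrefixpoints [HasLimits A] [HasColimits A] [HasStableMonos A]
    [SplitEpiCategory A] [WellPowered.{v} A] {J : Type v} [SmallCategory J] (D : J ⥤ Monad A)
    (hmono : ∀ j, (D.obj j).toFunctor.PreservesMonomorphisms)
    (hlarge : HasArbitrarilyLargeJointPrefixpoints (fun j => (D.obj j).toFunctor)) :
    HasColimit D := by
  have := isRightAdjoint_forget hmono hlarge
  exact (algebraicColimitOfAdjunction
    (Adjunction.ofIsRightAdjoint (DiagramAlgebra.forget D))).hasColimit

theorem hasCoproduct_of_largeJointPrefixpoints [HasLimits A] [HasColimits A] [HasStableMonos A]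
    [SplitEpiCategory A] [WellPowered.{v} A] {I : Type v} (S : I → Monad A)
    (hmono : ∀ i, (S i).toFunctor.PreservesMonomorphisms)
    (hlarge : HasArbitrarilyLargeJointPrefixpoints (fun i => (S i).toFunctor)) :
    HasCoproduct S := by
  refine hasColimit_of_largeJointPrefixpoints (Discrete.functor S) (fun i => hmono i.as) ?_
  intro B K _
  obtain ⟨X, hX, h⟩ := hlarge B K
  exact ⟨X, fun i => hX i.as, h⟩

/-! ### Colimits as coequalizers of coproducts -/

section Presentation

variable {C : Type*} [Category* C] {J : Type*} [Category* J] (D : J ⥤ C) [HasColimit D]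
  [HasCoproduct D.obj] [HasCoproduct (arrowDomains D)]

/-- The canonical cofork from the colimit of a diagram. -/
noncomputable def colimitCofork : Cofork (domainMap D) (codomainMap D) :=
  Cofork.ofπ (P := colimit D) (Limits.Sigma.desc (colimit.ι D))
    (Limits.Sigma.hom_ext _ _ fun f => by
    simp [domainMap, codomainMap])

variable {D} in
/-- The cocone under a diagram that is given by a cofork of the two canonical morphisms. -/
noncomputable def coconeOfCofork (s : Cofork (domainMap D) (codomainMap D)) : Cocone D where
  pt := s.pt
  ι :=
    { app := fun j => Limits.Sigma.ι D.obj j ≫ s.π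
      naturality := fun j k f => by
        have h := congrArg (Limits.Sigma.ι (arrowDomains D) ⟨(j, k), f⟩ ≫ ·) s.condition
        simpa [domainMap, codomainMap] using h.symm }

/-- A colimit is the coequalizer of the two canonical morphisms between coproducts. -/
noncomputable def colimitCoforkIsColimit : IsColimit (colimitCofork D) :=
  Cofork.IsColimit.mk _ (fun s => colimit.desc D (coconeOfCofork s))
    (fun s => Limits.Sigma.hom_ext _ _ fun j => by simp [colimitCofork, coconeOfCofork])
    (fun s (m : colimit D ⟶ s.pt) hm => colimit.hom_ext fun j => by
      have hm' : Limits.Sigma.desc (colimit.ι D) ≫ m = s.π := hm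
      have h : Limits.Sigma.ι D.obj j ≫ s.π = colimit.ι D j ≫ m := by
        rw [← hm', Limits.Sigma.ι_desc_assoc]
      exact h.symm.trans (colimit.ι_desc (coconeOfCofork s) j).symm)

end Presentation

end SetLikeMonads

theorem mainTheorem3 {A : Type u} [Category.{v} A] [HasLimits A] [HasColimits A]
    [SetLikeMonads.HasStableMonos A] [SplitEpiCategory A] [WellPowered.{v} A]
    {J : Type v} [SmallCategory J] (D : J ⥤ Monad A)
    (hmono : ∀ j, (D.obj j).toFunctor.PreservesMonomorphisms)
    (hlarge : SetLikeMonads.HasArbitrarilyLargeJointPrefixpoints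
      (fun j => (D.obj j).toFunctor)) :
    ∃ (_ : HasColimit D) (_ : HasCoproduct D.obj)
      (_ : HasCoproduct (SetLikeMonads.arrowDomains D))
      (_ : HasCoequalizer (SetLikeMonads.domainMap D) (SetLikeMonads.codomainMap D))
      (e : coequalizer (SetLikeMonads.domainMap D) (SetLikeMonads.codomainMap D) ≅ colimit D),
      ∀ j, Limits.Sigma.ι D.obj j ≫
        coequalizer.π (SetLikeMonads.domainMap D) (SetLikeMonads.codomainMap D) ≫ e.hom =
          colimit.ι D j := by
  have h₁ : HasColimit D := SetLikeMonads.hasColimit_of_largeJointPrefixpoints D hmono hlarge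
  have h₂ : HasCoproduct D.obj :=
    SetLikeMonads.hasCoproduct_of_largeJointPrefixpoints D.obj hmono hlarge
  -- The family over arrows only repeats the functors S_j, so their joint pre-fixpoints serve here
  -- too.
  have h₃ : HasCoproduct (SetLikeMonads.arrowDomains D) :=
    SetLikeMonads.hasCoproduct_of_largeJointPrefixpoints _ (fun f => hmono f.1.1) fun B K _ =>
      let ⟨X, hX, h⟩ := hlarge B K
      ⟨X, fun f => hX f.1.1, h⟩
  have hc := SetLikeMonads.colimitCoforkIsColimit D
  have h₄ : HasCoequalizer (SetLikeMonads.domainMap D) (SetLikeMonads.codomainMap D) :=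
    ⟨⟨⟨_, hc⟩⟩⟩
  let e : coequalizer (SetLikeMonads.domainMap D) (SetLikeMonads.codomainMap D) ≅ colimit D :=
    (coequalizerIsCoequalizer _ _).coconePointUniqueUpToIso hc
  refine ⟨h₁, h₂, h₃, h₄, e, fun j => ?_⟩
  have h : coequalizer.π (SetLikeMonads.domainMap D) (SetLikeMonads.codomainMap D) ≫ e.hom =
      Limits.Sigma.desc (colimit.ι D) :=
    IsColimit.comp_coconePointUniqueUpToIso_hom (coequalizerIsCoequalizer _ _) hc
      WalkingParallelPair.one
  rw [h]
  exact Limits.Sigma.ι_desc _ _
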